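/- Let $\Sigma$ be a finite alphabet, and let $\mathbb{N}_{\max,+}=(\mathbb{N}\cup\{-\infty\},\max,+,-\infty,0)$ be the max-plus semiring. A weighted automaton $\mathcal{A}=(Q,\{M_a\}_{a\in\Sigma},I,F)$ over $\mathbb{N}_{\max,+}$ has a finite state set $Q$, matrices $M_a\in(\mathbb{N}\cup\{-\infty\})^{Q\times Q}$ and vectors $I,F\in(\mathbb{N}\cup\{-\infty\})^{Q}$; its output on $w=a_1\cdots a_l$ is $I^{t}\cdot M_{a_1}\cdots M_{a_l}\cdot F$, computed in $\mathbb{N}_{\max,+}$. An accepting run on $w$ is a sequence of states $q_0,\dots,q_l$ with $I(q_0)\ne-\infty$, $M_{a_i}(q_{i-1},q_i)\neq-\infty$ for $1\le i\le l$, and $F(q_l)\ne-\infty$. The automaton is finitely ambiguous if there is a bound $m$ such that every word has at most $m$ accepting runs. For $n>0$, an $n$-pumping representation of a word $w\in\Sigma^*$ is a factorisation $w=u_0\cdot\underline{v_1}\cdot u_1\cdot\underline{v_2}\cdots\underline{v_n}\cdot u_n$ with all $v_k$ nonempty. A refinement of it is a factorisation $w=x_0\cdot\underline{y_1}\cdot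 x_1\cdots\underline{y_n}\cdot x_n$ with all $y_k$ nonempty such that there are words $p_1,\dots,p_{n+1}$ and $s_0,\dots,s_n$ with $s_0=p_{n+1}=\epsilon$, $v_k=p_k\,y_k\,s_k$ for $1\le k\le n$, and $x_k=s_k\,u_k\,p_{k+1}$ for $0\le k\le n$. For $S\subseteq\{1,\dots,n\}$ and $i\in\mathbb{N}$, let $w(S,i)$ be the word obtained from the refinement by replacing $y_k$ by $y_k^i$ for every $k\in S$. Given $f:\Sigma^*\to\mathbb{N}$, the refinement is linear if for every $S\subseteq\{1,\dots,n\}$ there is $K\in\mathbb{N}$ with $f(w(S,i+1))=K+f(w(S,i))$ for all sufficiently large $i$; this (unique) $K$ is denoted $\Delta(S)$. For a linear refinement, $S$ is called decomposable if $\Delta(S)=\sum_{j\in S}\Delta(\{j\})$. **Theorem.** Let $f:\Sigma^*\to\mathbb{N}$ be the output function of a finitely ambiguous weighted automaton over $\mathbb{N}_{\max,+}$. Then there exists $N\in\mathbb{N}$ such that every $n$-pumping representation $u_0\cdot\underline{v_1}\cdot u_1\cdots\underline{v_n}\cdot u_n$ with $n\ge N$ and $|v_k|\ge N$ for all $k$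 has a linear refinement such that for every sequence $S_1,\dots,S_k$ of pairwise different nonempty subsets of $\{1,\dots,n\}$ with $k\ge N$, at least one of the following holds: - there exists $j$ such that $S_j$ is not decomposable; - there exist $j_1\neq j_2$ such that $\{l_1,l_2\}$ is decomposable for every $l_1\in S_{j_1}$ and every $l_2\in S_{j_2}$. -/

import Mathlib

open Filter

/-- The max-plus semiring `(ℕ ∪ {-∞}, max, +, -∞, 0)`: Mathlib's `Tropical` is the min-plus
construction, so the order of `ℕ` is reversed, and the added top element is `-∞`. -/
abbrev MaxPlus : Type := Tropical (WithTop ℕᵒᵈ)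

/-- The embedding of `ℕ` (the finite elements) into the max-plus semiring. -/
def MaxPlus.ofNat (n : ℕ) : MaxPlus :=
  Tropical.trop ((OrderDual.toDual n : ℕᵒᵈ) : WithTop ℕᵒᵈ)

theorem MaxPlus.ofNat_injective : Function.Injective MaxPlus.ofNat := by
  intro a b h
  have h1 := WithTop.coe_injective (Tropical.trop_injective h)
  exact OrderDual.toDual.injective h1

theorem MaxPlus.ofNat_ne_zero (n : ℕ) : MaxPlus.ofNat n ≠ 0 := by
  intro h
  have h1 : ((OrderDual.toDual n : ℕᵒᵈ) : WithTop ℕᵒᵈ) = ⊤ := Tropical.trop_injective h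
  exact WithTop.coe_ne_top h1

theorem MaxPlus.eq_zero_or_ofNat (x : MaxPlus) : x = 0 ∨ ∃ n, x = MaxPlus.ofNat n := by
  induction x using Tropical.tropRec with
  | _ x =>
    induction x using WithTop.recTopCoe with
    | top => exact Or.inl rfl
    | coe a => exact Or.inr ⟨OrderDual.ofDual a, rfl⟩

theorem MaxPlus.ofNat_add (a b : ℕ) :
    MaxPlus.ofNat a + MaxPlus.ofNat b = MaxPlus.ofNat (max a b) := by
  rcases le_total a b with h | h
  · rw [max_eq_right h]
    refine Tropical.add_eq_right ?_
    exact WithTop.coe_le_coe.2 (OrderDual.toDual_le_toDual.2 h)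
  · rw [max_eq_left h]
    refine Tropical.add_eq_left ?_
    exact WithTop.coe_le_coe.2 (OrderDual.toDual_le_toDual.2 h)

theorem MaxPlus.ofNat_mul (a b : ℕ) :
    MaxPlus.ofNat a * MaxPlus.ofNat b = MaxPlus.ofNat (a + b) := rfl

theorem MaxPlus.ofNat_zero : MaxPlus.ofNat 0 = 1 := rfl

/-- A weighted automaton over the alphabet `α` with weights in `R` and set of states `Q`. -/
structure WeightedAutomaton (α : Type*) (R : Type*) (Q : Type*) where
  /-- the transition matrices -/
  trans : α → Matrix Q Q R
  /-- the initial vector -/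
  init : Q → R
  /-- the final vector -/
  final : Q → R

namespace WeightedAutomaton

variable {α R Q : Type*} [CommSemiring R] (A : WeightedAutomaton α R Q)

/-- The accepting runs of `A` over `w = a₁ … aₗ`, given by their states `q₀, …, qₗ` (the `i`-th
transition, with its weight, is determined by `qᵢ₋₁`, `aᵢ` and `qᵢ`). -/
def acceptingRuns (w : List α) : Set (Fin (w.length + 1) → Q) :=
  {q | A.init (q 0) ≠ 0 ∧
    (∀ i : Fin w.length, A.trans (w.get i) (q i.castSucc) (q i.succ) ≠ 0) ∧
    A.final (q (Fin.last w.length)) ≠ 0}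

/-- `A` is finitely ambiguous: the number of accepting runs over a word is uniformly bounded. -/
def FinitelyAmbiguous : Prop :=
  ∃ m : ℕ, ∀ w : List α, (A.acceptingRuns w).encard ≤ m

/-- The matrix `M_w = M_{a₁} ⋯ M_{aₗ}` of the word `w = a₁ … aₗ`. -/
def wordMatrix [Fintype Q] [DecidableEq Q] (w : List α) : Matrix Q Q R :=
  (w.map A.trans).prod

/-- The output `Iᵗ · M_w · F` of `A` over the word `w`. -/
def output [Fintype Q] [DecidableEq Q] (w : List α) : R :=
  dotProduct A.init (Matrix.mulVec (A.wordMatrix w) A.final)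

end WeightedAutomaton

/-- `f : Σ* → ℕ` is defined by a finitely ambiguous weighted automaton over the max-plus
semiring. (Every finite set of states can be taken to be of the form `Fin d`.) -/
def IsFinitelyAmbiguousMaxPlus {α : Type*} (f : List α → ℕ) : Prop :=
  ∃ (d : ℕ) (A : WeightedAutomaton α MaxPlus (Fin d)),
    A.FinitelyAmbiguous ∧ ∀ w, A.output w = MaxPlus.ofNat (f w)

/-- An `n`-pumping representation `u₀ · v₁ · u₁ · v₂ ⋯ vₙ · uₙ` over the alphabet `α`, the factors
`v₁, …, vₙ` being the underlined ones (`v k` with `k : Fin n` is `vₖ₊₁`). -/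
structure PumpingRep (α : Type*) (n : ℕ) where
  /-- the factors that are not underlined -/
  u : Fin (n + 1) → List α
  /-- the underlined factors -/
  v : Fin n → List α
  pos : 0 < n
  v_ne_nil : ∀ k, v k ≠ []

namespace PumpingRep

variable {α : Type*} {n : ℕ}

/-- The word `w(S, i)`: every underlined factor with index in `S` is repeated `i` times. -/
def pump (r : PumpingRep α n) (S : Finset (Fin n)) (i : ℕ) : List α :=
  r.u 0 ++ (List.ofFn fun k : Fin n =>
    (List.replicate (if k ∈ S then i else 1) (r.v k)).flatten ++ r.u k.succ).flatten

/-- `r'` is a refinement of `r`: with `r = u₀ · v₁ · u₁ ⋯ vₙ · uₙ` and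
`r' = u'₀ · y₁ · u'₁ ⋯ yₙ · u'ₙ` there are words with `vₖ = xₖ · yₖ · zₖ` for `1 ≤ k ≤ n` and
`u'ₖ = zₖ · uₖ · xₖ₊₁` for `0 ≤ k ≤ n`, where `z₀` and `xₙ₊₁` are empty. Here `x k` stands for
`xₖ₊₁` and `z k` for `zₖ`, with `0 ≤ k ≤ n`. -/
def IsRefinement (r' r : PumpingRep α n) : Prop :=
  ∃ x z : Fin (n + 1) → List α,
    z 0 = [] ∧ x (Fin.last n) = [] ∧
    (∀ k : Fin n, r.v k = x k.castSucc ++ r'.v k ++ z k.succ) ∧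
    (∀ k : Fin (n + 1), r'.u k = z k ++ r.u k ++ x k)

/-- `r` is linear for `f`: pumping any set of indices eventually adds a constant at each step. -/
def IsLinear (f : List α → ℕ) (r : PumpingRep α n) : Prop :=
  ∀ S : Finset (Fin n), ∃ K : ℕ, ∀ᶠ i in atTop, f (r.pump S (i + 1)) = K + f (r.pump S i)

/-- The constant `Δ(S)` of a linear representation. -/
noncomputable def Delta {f : List α → ℕ} {r : PumpingRep α n} (h : r.IsLinear f)
    (S : Finset (Fin n)) : ℕ :=
  (h S).choose

theorem Delta_eq_iff {f : List α → ℕ} {r : PumpingRep α n} (h : r.IsLinear f)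
    (S : Finset (Fin n)) (K : ℕ) :
    Delta h S = K ↔ ∀ᶠ i in atTop, f (r.pump S (i + 1)) = K + f (r.pump S i) := by
  have hs := (h S).choose_spec
  constructor
  · rintro rfl
    exact hs
  · intro hK
    obtain ⟨i, h1, h2⟩ := (hs.and hK).exists
    exact Nat.add_right_cancel (h1.symm.trans h2)

/-- `S` is decomposable: `Δ(S) = ∑_{j ∈ S} Δ({j})`. -/
def Decomposable {f : List α → ℕ} {r : PumpingRep α n} (h : r.IsLinear f)
    (S : Finset (Fin n)) : Prop :=
  Delta h S = ∑ j ∈ S, Delta h {j}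

end PumpingRep

/-! A Ramsey argument refines each underlined factor so that the support of its matrix is an
idempotent relation (`exists_isRefinement_supportIdempotent`). Finite ambiguity then forces
accepting runs over a pumped factor to wait in a single loop state: an edge between two distinct
looped states would give unboundedly many runs (`Usable.onlyLoops`). The runs thus fall into shapes
`σ`, each contributing an affine function of the exponent with slope `∑ k ∈ S, c σ k`, where `c σ k`
is a loop weight, and `Δ(S)` is the largest slope. Distinct shapes give distinct runs on the word
with all factors doubled, so the ambiguity bound `m` also bounds their number, whatever `n` is
(`card_shapes_le`).

A set is decomposable iff one shape is optimal at all its indices simultaneously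
(`decomposable_iff`). Among more than `m` decomposable sets, two share such a shape by pigeonhole;
it is optimal on their union, so every cross pair is decomposable. -/

/-! ### Combinatorial preliminaries. -/

/-- Ramsey's theorem for triangles, by induction on the number of colours. Join the least element
`a` to the rest and keep the neighbours in a popular colour `x`: an edge of colour `x` among them
closes a triangle with `a`, and otherwise `x` is lost there. -/
theorem exists_monochromatic_triple {κ : Type*} (C : Finset κ) :
    ∃ N : ℕ, ∀ (A : Finset ℕ) (c : ℕ → ℕ → κ), N ≤ A.card →
      (∀ i ∈ A, ∀ j ∈ A, i < j → c i j ∈ C) →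
      ∃ i j k, i ∈ A ∧ j ∈ A ∧ k ∈ A ∧ i < j ∧ j < k ∧ c i j = c i k ∧ c j k = c i k := by
  classical
  obtain ⟨r, hr⟩ : ∃ r, C.card = r := ⟨_, rfl⟩
  induction r generalizing C with
  | zero =>
    refine ⟨2, fun A c hA h => ?_⟩
    obtain ⟨i, hi, j, hj, hij⟩ := Finset.one_lt_card.1 hA
    rw [Finset.card_eq_zero] at hr
    subst hr
    rcases lt_or_gt_of_ne hij with h1 | h1
    · exact absurd (h i hi j hj h1) (by simp)
    · exact absurd (h j hj i hi h1) (by simp)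
  | succ r ih =>
    choose! N hN using fun x (hx : x ∈ C) => ih (C.erase x) (by simp [Finset.card_erase_of_mem hx, hr])
    refine ⟨(∑ x ∈ C, N x) + 2, fun A c hA h => ?_⟩
    have hne : A.Nonempty := Finset.card_pos.1 (by omega)
    set a := A.min' hne with ha
    have haA : a ∈ A := A.min'_mem hne
    have hlt : ∀ j ∈ A.erase a, a < j := fun j hj =>
      lt_of_le_of_ne (A.min'_le j (Finset.mem_of_mem_erase hj)) (Finset.ne_of_mem_erase hj).symm
    have hmaps : ∀ j ∈ A.erase a, c a j ∈ C := fun j hj =>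
      h a haA j (Finset.mem_of_mem_erase hj) (hlt j hj)
    have hsum := Finset.card_eq_sum_card_fiberwise hmaps
    obtain ⟨x, hx, hxN⟩ : ∃ x ∈ C, N x ≤ ((A.erase a).filter fun j => c a j = x).card := by
      by_contra! hcon
      have := Finset.sum_le_sum fun x hx => (hcon x hx).le
      rw [Finset.card_erase_of_mem haA] at hsum
      omega
    set B := (A.erase a).filter fun j => c a j = x with hB
    have hBA : ∀ j ∈ B, j ∈ A.erase a ∧ c a j = x := fun j hj => Finset.mem_filter.1 hj
    by_cases hc : ∃ i ∈ B, ∃ j ∈ B, i < j ∧ c i j = x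
    · obtain ⟨i, hi, j, hj, hij, e⟩ := hc
      exact ⟨a, i, j, haA, Finset.mem_of_mem_erase (hBA i hi).1,
        Finset.mem_of_mem_erase (hBA j hj).1, hlt i (hBA i hi).1, hij,
        (hBA i hi).2.trans (hBA j hj).2.symm, e.trans (hBA j hj).2.symm⟩
    · push Not at hc
      obtain ⟨i, j, k, hi, hj, hk, h1⟩ := hN x hx B c hxN fun i hi j hj hij =>
        Finset.mem_erase.2 ⟨hc i hi j hj hij, h i (Finset.mem_of_mem_erase (hBA i hi).1) j
          (Finset.mem_of_mem_erase (hBA j hj).1) hij⟩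
      exact ⟨i, j, k, Finset.mem_of_mem_erase (hBA i hi).1, Finset.mem_of_mem_erase (hBA j hj).1,
        Finset.mem_of_mem_erase (hBA k hk).1, h1⟩

/-- Long words have a nonempty factor `y = y₁ y₂` such that `y₁`, `y₂` and `y` have the same
image under a map with finite range. -/
theorem exists_repetitive_factor {α κ : Type*} [Finite κ] (φ : List α → κ) :
    ∃ N : ℕ, ∀ w : List α, N ≤ w.length →
      ∃ x y₁ y₂ z : List α, w = x ++ (y₁ ++ y₂) ++ z ∧ y₁ ≠ [] ∧
        φ y₁ = φ (y₁ ++ y₂) ∧ φ y₂ = φ (y₁ ++ y₂) := by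
  classical
  have := Fintype.ofFinite κ
  obtain ⟨N, hN⟩ := exists_monochromatic_triple (Finset.univ : Finset κ)
  refine ⟨N, fun w hw => ?_⟩
  -- Positions in `w` are the vertices; a pair `i < j` is coloured by the image of the factor
  -- between them.
  obtain ⟨i, j, k, hi, hj, hk, hij, hjk, e1, e2⟩ := hN (Finset.range (w.length + 1))
    (fun i j => φ ((w.drop i).take (j - i))) (by simp; omega) (by simp)
  have key : (w.drop i).take (k - i) =
      (w.drop i).take (j - i) ++ (w.drop j).take (k - j) := by
    have : k - i = (j - i) + (k - j) := by omega
    rw [this, List.take_add, List.drop_drop]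
    congr 3
    omega
  simp only [Finset.mem_range] at hi hj hk
  simp only [key] at e1 e2
  refine ⟨w.take i, _, _, w.drop k, ?_, ?_, e1, e2⟩
  · rw [← key]
    have : w.drop k = (w.drop i).drop (k - i) := by
      rw [List.drop_drop]
      congr 1
      omega
    rw [this, List.append_assoc, List.take_append_drop, List.take_append_drop]
  · intro h
    have := congrArg List.length h
    simp at this
    omega

/-- An idempotent relation is transitive and dense. Without a reflexive point, the states between
`p` and `q` would form a finite strict order, and density below a minimal one is absurd. -/
theorem exists_reflexive_between {Q : Type*} [Finite Q] (e : Q → Q → Prop)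
    (he : ∀ p q, e p q ↔ ∃ t, e p t ∧ e t q) {p q : Q} (h : e p q) :
    ∃ s, e p s ∧ e s s ∧ e s q := by
  have tr : ∀ {a b c}, e a b → e b c → e a c := fun h1 h2 => (he _ _).2 ⟨_, h1, h2⟩
  by_contra! hcon
  let D := {s // e p s ∧ e s q}
  let r : D → D → Prop := fun a b => e a.1 b.1
  have : IsTrans D r := ⟨fun a b c h1 h2 => tr h1 h2⟩
  have : Std.Irrefl r := ⟨fun a h => hcon a.1 a.2.1 h a.2.2⟩
  have wf : WellFounded r := Finite.wellFounded_of_trans_of_irrefl r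
  obtain ⟨t, h1, h2⟩ := (he _ _).1 h
  obtain ⟨m, -, hm⟩ := wf.has_min Set.univ ⟨⟨t, h1, h2⟩, trivial⟩
  obtain ⟨t', h3, h4⟩ := (he _ _).1 m.2.1
  exact hm ⟨t', h3, tr h4 m.2.2⟩ trivial h4

/-- Among the terms of largest slope, the one with the largest intercept wins once `j` exceeds every
intercept: a smaller slope then costs at least `j`. -/
theorem eventually_sup_affine_succ {ι : Type*} (s : Finset ι) (hs : s.Nonempty) (b C : ι → ℕ) :
    ∀ᶠ j in atTop, (s.sup fun σ => b σ + (j + 1) * C σ) =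
      s.sup C + s.sup fun σ => b σ + j * C σ := by
  classical
  obtain ⟨τ, hτ, hK⟩ := s.exists_mem_eq_sup hs C
  have hne : (s.filter fun σ => C σ = C τ).Nonempty := ⟨τ, by simp [hτ]⟩
  obtain ⟨ρ, hρ, hmax⟩ := Finset.exists_max_image _ b hne
  rw [Finset.mem_filter] at hρ
  have key : ∀ j ≥ s.sup b, (s.sup fun σ => b σ + j * C σ) = b ρ + j * C τ := by
    intro j hj
    apply le_antisymm
    · refine Finset.sup_le fun σ hσ => ?_
      by_cases h : C σ = C τ
      · rw [h]
        have := hmax σ (Finset.mem_filter.2 ⟨hσ, h⟩)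
        omega
      · have h1 : C σ ≤ C τ := hK ▸ Finset.le_sup hσ
        have h2 : b σ ≤ j := (Finset.le_sup hσ).trans hj
        have h3 : j * (C σ + 1) ≤ j * C τ := Nat.mul_le_mul_left _ (by omega)
        rw [Nat.mul_succ] at h3
        omega
    · rw [← hρ.2]
      exact Finset.le_sup (f := fun σ => b σ + j * C σ) hρ.1
  filter_upwards [eventually_ge_atTop (s.sup b)] with j hj
  rw [key j hj, key (j + 1) (by omega), hK]
  ring

/-! ### Supports of matrices and expansion over paths. -/

namespace Matrix

variable {Q R : Type*} [Fintype Q] [CommSemiring R]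

/-- The support of `M` is contained in the support of `N`. -/
def SupportLE (M : Matrix Q Q R) (N : Matrix Q Q ℕ) : Prop :=
  ∀ p q, M p q ≠ 0 → N p q ≠ 0

/-- Sums in `ℕ` do not cancel, so a single nonzero term suffices. -/
theorem dotProduct_ne_zero_of_support {v w : Q → R} {v' w' : Q → ℕ}
    (hv : ∀ p, v p ≠ 0 → v' p ≠ 0) (hw : ∀ p, w p ≠ 0 → w' p ≠ 0)
    (h : dotProduct v w ≠ 0) : dotProduct v' w' ≠ 0 := by
  obtain ⟨p, -, hp⟩ := Finset.exists_ne_zero_of_sum_ne_zero h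
  intro h0
  have := (Finset.sum_eq_zero_iff.1 h0) p (Finset.mem_univ p)
  exact mul_ne_zero (hv p (left_ne_zero_of_mul hp)) (hw p (right_ne_zero_of_mul hp)) this

theorem SupportLE.mul {M M' : Matrix Q Q R} {N N' : Matrix Q Q ℕ}
    (h : M.SupportLE N) (h' : M'.SupportLE N') : (M * M').SupportLE (N * N') := fun p q hpq =>
  dotProduct_ne_zero_of_support (h p) (fun t => h' t q) hpq

theorem SupportLE.list_prod [DecidableEq Q] {ι : Type*} (f : ι → Matrix Q Q R)
    (g : ι → Matrix Q Q ℕ) (h : ∀ i, (f i).SupportLE (g i)) (l : List ι) :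
    (l.map f).prod.SupportLE (l.map g).prod := by
  induction l with
  | nil =>
    intro p q h
    by_cases hpq : p = q
    · subst hpq
      simp
    · exact absurd (Matrix.one_apply_ne hpq) h
  | cons i l ih => simpa using (h i).mul ih

theorem dotProduct_prod_mulVec_eq_sum [DecidableEq Q] {l : ℕ} (M : Fin l → Matrix Q Q R)
    (v w : Q → R) :
    dotProduct v ((List.ofFn M).prod.mulVec w) =
      ∑ q : Fin (l + 1) → Q, v (q 0) * (∏ i : Fin l, M i (q i.castSucc) (q i.succ)) *
        w (q (Fin.last l)) := by
  induction l generalizing v with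
  | zero =>
    rw [← Equiv.sum_comp (Equiv.funUnique (Fin 1) Q).symm]
    simp [dotProduct]
  | succ l ih =>
    rw [List.ofFn_succ, List.prod_cons, ← Matrix.mulVec_mulVec, Matrix.dotProduct_mulVec, ih,
      ← Equiv.sum_comp (Fin.consEquiv fun _ : Fin (l + 1 + 1) => Q), Fintype.sum_prod_type,
      Finset.sum_comm]
    refine Finset.sum_congr rfl fun q _ => ?_
    rw [Matrix.vecMul, dotProduct, Finset.sum_mul, Finset.sum_mul]
    refine Finset.sum_congr rfl fun s _ => ?_
    rw [Fin.prod_univ_succ, ← Fin.succ_last]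
    simp only [Fin.consEquiv, Equiv.coe_fn_mk, Fin.cons_succ, Fin.cons_zero, Fin.castSucc_zero,
      ← Fin.succ_castSucc]
    ring

end Matrix

/-! ### Counting runs, and outputs as multilinear functions of the pumped factors. -/

namespace WeightedAutomaton

variable {α R Q : Type*} [CommSemiring R] (A : WeightedAutomaton α R Q)

section Output

variable [Fintype Q] [DecidableEq Q]

theorem wordMatrix_append (w w' : List α) :
    A.wordMatrix (w ++ w') = A.wordMatrix w * A.wordMatrix w' := by
  simp [wordMatrix]

theorem wordMatrix_flatten (L : List (List α)) :
    A.wordMatrix L.flatten = (L.map A.wordMatrix).prod := by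
  induction L with
  | nil => simp [wordMatrix]
  | cons w L ih => simp [wordMatrix_append, ih]

theorem wordMatrix_eq_ofFn_prod (w : List α) :
    A.wordMatrix w = (List.ofFn fun i => A.trans (w.get i)).prod := by
  rw [wordMatrix, ← Function.comp_def, ← List.map_ofFn, List.ofFn_get]

end Output

open Classical in
/-- The automaton over `ℕ` whose output is the number of accepting runs of `A`. -/
noncomputable def counting : WeightedAutomaton α ℕ Q where
  trans a p q := if A.trans a p q = 0 then 0 else 1
  init q := if A.init q = 0 then 0 else 1
  final q := if A.final q = 0 then 0 else 1

variable [Fintype Q] [DecidableEq Q]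

theorem counting_output (w : List α) :
    (A.counting.output w : ℕ∞) = (A.acceptingRuns w).encard := by
  classical
  have h : A.acceptingRuns w = ((Finset.univ.filter fun q => q ∈ A.acceptingRuns w :
    Finset (Fin (w.length + 1) → Q)) : Set (Fin (w.length + 1) → Q)) := by simp
  rw [h, Set.encard_coe_eq_coe_finsetCard, output, wordMatrix_eq_ofFn_prod,
    Matrix.dotProduct_prod_mulVec_eq_sum, Finset.card_filter]
  congr 1
  refine Finset.sum_congr rfl fun q _ => ?_
  have hprod : (∏ i : Fin w.length, A.counting.trans (w.get i) (q i.castSucc) (q i.succ)) =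
      if ∀ i : Fin w.length, A.trans (w.get i) (q i.castSucc) (q i.succ) ≠ 0 then 1 else 0 := by
    split_ifs with h
    · exact Finset.prod_eq_one fun i _ => if_neg (h i)
    · push Not at h
      obtain ⟨i, hi⟩ := h
      exact Finset.prod_eq_zero (Finset.mem_univ i) (if_pos hi)
  rw [hprod]
  simp only [counting, acceptingRuns, Set.mem_ofPred_eq]
  by_cases h1 : A.init (q 0) = 0 <;> by_cases h2 : A.final (q (Fin.last w.length)) = 0 <;>
    simp [h1, h2]

theorem supportLE_counting_wordMatrix (w : List α) :
    (A.wordMatrix w).SupportLE (A.counting.wordMatrix w) :=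
  Matrix.SupportLE.list_prod _ _ (fun a p q h => by simp [counting, h]) w

variable {n : ℕ}

/-- The output of `A` on `u₀ · y₁ · u₁ ⋯ yₙ · uₙ`, as a multilinear function of the matrices of
the factors `y₁, …, yₙ`. -/
noncomputable def blockForm (u : Fin (n + 1) → List α) :
    MultilinearMap R (fun _ : Fin n => Matrix Q Q R) R :=
  LinearMap.compMultilinearMap
    { toFun := fun M => dotProduct A.init (Matrix.mulVec (A.wordMatrix (u 0) * M) A.final)
      map_add' := fun M N => by simp [mul_add, Matrix.add_mulVec, dotProduct_add]
      map_smul' := fun c M => by simp [Matrix.smul_mulVec, dotProduct_smul] }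
    ((MultilinearMap.mkPiAlgebraFin R n (Matrix Q Q R)).compLinearMap
      fun k => LinearMap.mulRight R (A.wordMatrix (u k.succ)))

theorem blockForm_apply (u : Fin (n + 1) → List α) (Y : Fin n → Matrix Q Q R) :
    A.blockForm u Y = dotProduct A.init (Matrix.mulVec (A.wordMatrix (u 0) *
      (List.ofFn fun k => Y k * A.wordMatrix (u k.succ)).prod) A.final) := by
  simp [blockForm]

theorem output_pump (r : PumpingRep α n) (S : Finset (Fin n)) (i : ℕ) :
    A.output (r.pump S i) =
      A.blockForm r.u fun k => A.wordMatrix (r.v k) ^ (if k ∈ S then i else 1) := by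
  simp only [output, PumpingRep.pump, blockForm_apply, wordMatrix_append, wordMatrix_flatten,
    List.map_ofFn, Function.comp_def, List.map_replicate, List.prod_replicate]

/-- The weight of the part of the runs that reads `u₀, …, uₙ`, when the factors `y₁, …, yₙ` are
read from the states `(t k).1` to the states `(t k).2`. -/
noncomputable def contextWeight (u : Fin (n + 1) → List α) (t : Fin n → Q × Q) : R :=
  A.blockForm u fun k => Matrix.single (t k).1 (t k).2 1

/-- Expanding each block in matrix units separates the context, which pumping leaves fixed, from the
entries of the pumped powers. -/
theorem blockForm_eq_sum (u : Fin (n + 1) → List α) (Y : Fin n → Matrix Q Q R) :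
    A.blockForm u Y = ∑ t : Fin n → Q × Q, A.contextWeight u t * ∏ k, Y k (t k).1 (t k).2 := by
  have h : Y = fun k => ∑ x : Q × Q, Y k x.1 x.2 • Matrix.single x.1 x.2 (1 : R) := by
    funext k
    rw [Fintype.sum_prod_type]
    conv_lhs => rw [Matrix.matrix_eq_sum_single (Y k)]
    simp [Matrix.smul_single]
  conv_lhs => rw [h]
  rw [MultilinearMap.map_sum]
  refine Finset.sum_congr rfl fun t _ => ?_
  rw [MultilinearMap.map_smul_univ, smul_eq_mul, mul_comm]
  rfl

theorem contextWeight_counting_ne_zero (u : Fin (n + 1) → List α) (t : Fin n → Q × Q)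
    (h : A.contextWeight u t ≠ 0) : A.counting.contextWeight u t ≠ 0 := by
  rw [contextWeight, blockForm_apply] at h ⊢
  refine Matrix.dotProduct_ne_zero_of_support (fun p hp => by simp [counting, hp])
    (fun p => Matrix.dotProduct_ne_zero_of_support (fun q => ?_)
      fun q hq => by simp [counting, hq]) h
  refine (A.supportLE_counting_wordMatrix _).mul ?_ p q
  rw [List.ofFn_eq_map, List.ofFn_eq_map]
  exact Matrix.SupportLE.list_prod _ _ (fun k => Matrix.SupportLE.mul (fun p q hpq => by
    by_contra h0
    simp_all [Matrix.single_apply]) (A.supportLE_counting_wordMatrix _)) _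

end WeightedAutomaton

/-! ### Max-plus arithmetic. -/

namespace MaxPlus

theorem exists_val : ∃ val : MaxPlus → ℕ, ∀ x, x ≠ 0 → x = ofNat (val x) := by
  choose! val h using fun (x : MaxPlus) (hx : x ≠ 0) => (eq_zero_or_ofNat x).resolve_left hx
  exact ⟨val, h⟩

theorem ofNat_pow (a j : ℕ) : ofNat a ^ j = ofNat (j * a) := by
  induction j with
  | zero => simp [ofNat_zero]
  | succ j ih => rw [pow_succ, ih, ofNat_mul, Nat.succ_mul]

theorem prod_ofNat {ι : Type*} (s : Finset ι) (g : ι → ℕ) :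
    ∏ i ∈ s, ofNat (g i) = ofNat (∑ i ∈ s, g i) := by
  induction s using Finset.cons_induction with
  | empty => simp [ofNat_zero]
  | cons a s ha ih => rw [Finset.prod_cons, Finset.sum_cons, ih, ofNat_mul]

theorem sum_ofNat {ι : Type*} {s : Finset ι} (hs : s.Nonempty) (g : ι → ℕ) :
    ∑ i ∈ s, ofNat (g i) = ofNat (s.sup g) := by
  induction hs using Finset.Nonempty.cons_induction with
  | singleton a => simp
  | cons a s ha hs ih => rw [Finset.sum_cons, Finset.sup_cons, ih, ofNat_add]

/-- Max-plus addition is idempotent, so an unpumped factor may be counted once for each choice of a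
dummy loop state. -/
theorem sum_const_of_nonempty {ι : Type*} {s : Finset ι} (hs : s.Nonempty) (x : MaxPlus) :
    ∑ _i ∈ s, x = x := by
  induction hs using Finset.Nonempty.cons_induction with
  | singleton a => simp
  | cons a s ha hs ih => rw [Finset.sum_cons, ih, Tropical.add_self]

end MaxPlus

/-! ### Powers of matrices with idempotent support. -/

namespace Matrix

variable {Q R : Type*} [Fintype Q] [CommSemiring R]

/-- The support of `M`, as a relation, is idempotent. -/
def SupportIdempotent (M : Matrix Q Q R) : Prop :=
  ∀ p q, M p q ≠ 0 ↔ ∃ t, M p t ≠ 0 ∧ M t q ≠ 0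

open Classical in
/-- The states `s` with a loop that lie between `p` and `q`. -/
noncomputable def loopStates (M : Matrix Q Q R) (p q : Q) : Finset Q :=
  Finset.univ.filter fun s => M p s ≠ 0 ∧ M s s ≠ 0 ∧ M s q ≠ 0

theorem mem_loopStates {M : Matrix Q Q R} {p q s : Q} :
    s ∈ M.loopStates p q ↔ M p s ≠ 0 ∧ M s s ≠ 0 ∧ M s q ≠ 0 := by
  simp [loopStates]

theorem SupportIdempotent.loopStates_nonempty {M : Matrix Q Q R} (hM : M.SupportIdempotent)
    {p q : Q} (h : M p q ≠ 0) : (M.loopStates p q).Nonempty := by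
  obtain ⟨s, hs⟩ := exists_reflexive_between (fun p q => M p q ≠ 0) hM h
  exact ⟨s, mem_loopStates.2 hs⟩

theorem SupportIdempotent.of_pow [DecidableEq Q] {M : Matrix Q Q R} (hM : M.SupportIdempotent) (j : ℕ) {p q : Q}
    (h : (M ^ (j + 1)) p q ≠ 0) : M p q ≠ 0 := by
  induction j generalizing q with
  | zero => simpa using h
  | succ j ih =>
    rw [pow_succ, Matrix.mul_apply] at h
    obtain ⟨t, -, ht⟩ := Finset.exists_ne_zero_of_sum_ne_zero h
    exact (hM p q).2 ⟨t, ih (left_ne_zero_of_mul ht), right_ne_zero_of_mul ht⟩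

/-- Between `p` and `q`, the only steps of `M` are loops. -/
def OnlyLoops (M : Matrix Q Q R) (p q : Q) : Prop :=
  ∀ t t', M p t ≠ 0 → M t t' ≠ 0 → M t' q ≠ 0 → t = t'

/-- All intermediate states of a contributing path coincide: one step enters `s`, `j` steps loop
there, one step leaves. -/
theorem SupportIdempotent.pow_eq_sum [DecidableEq Q] {M : Matrix Q Q R} (hM : M.SupportIdempotent) {p q : Q}
    (h : M.OnlyLoops p q) (j : ℕ) :
    (M ^ (j + 2)) p q = ∑ s ∈ M.loopStates p q, M p s * M s s ^ j * M s q := by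
  have key : ∀ s, M s q ≠ 0 → (M ^ (j + 1)) p s = M p s * M s s ^ j := by
    intro s hs
    induction j with
    | zero => simp
    | succ j ih =>
      rw [pow_succ, Matrix.mul_apply, Finset.sum_eq_single s, ih, pow_succ, mul_assoc]
      · intro t _ hts
        by_contra h0
        exact hts (h t s (hM.of_pow j (left_ne_zero_of_mul h0)) (right_ne_zero_of_mul h0) hs)
      · simp
  rw [pow_succ, Matrix.mul_apply, ← Finset.sum_subset (Finset.subset_univ (M.loopStates p q))]
  · exact Finset.sum_congr rfl fun s hs => by rw [key s (mem_loopStates.1 hs).2.2]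
  · intro s _ hs
    by_contra h0
    have h1 := hM.of_pow j (left_ne_zero_of_mul h0)
    have h2 := right_ne_zero_of_mul h0
    -- Density puts some `t` between `s` and `q`; `OnlyLoops` gives `t = s`, which is the loop at
    -- `s`.
    obtain ⟨t, h3, h4⟩ := (hM s q).1 h2
    exact hs (mem_loopStates.2 ⟨h1, (h s t h1 h3 h4) ▸ h3, h2⟩)

/-- Any `t` between `p` and `q` has loop states before and after it. By hypothesis these agree, so
`t` lies on a cycle and by transitivity is itself a loop state. -/
theorem SupportIdempotent.onlyLoops {M : Matrix Q Q R} (hM : M.SupportIdempotent) {p q : Q}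
    (h : ∀ s ∈ M.loopStates p q, ∀ s' ∈ M.loopStates p q, M s s' ≠ 0 → s = s') :
    M.OnlyLoops p q := by
  have tr : ∀ {a b c}, M a b ≠ 0 → M b c ≠ 0 → M a c ≠ 0 := fun h1 h2 => (hM _ _).2 ⟨_, h1, h2⟩
  have loop : ∀ t, M p t ≠ 0 → M t q ≠ 0 → M t t ≠ 0 := by
    intro t h1 h2
    obtain ⟨s, hs⟩ := hM.loopStates_nonempty h1
    obtain ⟨s', hs'⟩ := hM.loopStates_nonempty h2
    rw [mem_loopStates] at hs hs'
    have := h s (mem_loopStates.2 ⟨hs.1, hs.2.1, tr hs.2.2 h2⟩) s'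
      (mem_loopStates.2 ⟨tr h1 hs'.1, hs'.2⟩) (tr hs.2.2 hs'.1)
    exact tr hs'.1 (this ▸ hs.2.2)
  intro t t' h1 h2 h3
  exact h t (mem_loopStates.2 ⟨h1, loop t h1 (tr h2 h3), tr h2 h3⟩) t'
    (mem_loopStates.2 ⟨tr h1 h2, loop t' (tr h1 h2) h3, h3⟩) h2

/-- The moment of the switch from `s` to `s'` can be chosen in `i` ways. -/
theorem le_pow_apply [DecidableEq Q] (N : Matrix Q Q ℕ) {s s' : Q} (hne : s ≠ s') (h1 : N s s ≠ 0)
    (h2 : N s s' ≠ 0) (h3 : N s' s' ≠ 0) (i : ℕ) : i ≤ (N ^ i) s s' := by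
  have mul_le : ∀ (i : ℕ) (a b c : Q), (N ^ i) a b * N b c ≤ (N ^ (i + 1)) a c := by
    intro i a b c
    rw [pow_succ, Matrix.mul_apply]
    exact Finset.single_le_sum (f := fun b => (N ^ i) a b * N b c) (fun _ _ => Nat.zero_le _)
      (Finset.mem_univ b)
  have hloop : ∀ i, 1 ≤ (N ^ i) s s := by
    intro i
    induction i with
    | zero => simp
    | succ i ih => exact (Nat.mul_le_mul ih (Nat.pos_of_ne_zero h1)).trans (mul_le i s s s)
  induction i with
  | zero => simp
  | succ i ih =>
    rw [pow_succ, Matrix.mul_apply]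
    calc i + 1 ≤ (N ^ i) s s' * N s' s' + (N ^ i) s s * N s s' :=
          Nat.add_le_add (ih.trans (Nat.le_mul_of_pos_right _ (Nat.pos_of_ne_zero h3)))
            (Nat.mul_le_mul (hloop i) (Nat.pos_of_ne_zero h2))
      _ = ∑ b ∈ {s', s}, (N ^ i) s b * N b s' := by rw [Finset.sum_pair hne.symm]
      _ ≤ _ := Finset.sum_le_sum_of_subset (Finset.subset_univ _)

theorem le_pow_apply_of_loopStates [DecidableEq Q] {M : Matrix Q Q R} {N : Matrix Q Q ℕ} (hMN : M.SupportLE N)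
    {p q s s' : Q} (hs : s ∈ M.loopStates p q) (hs' : s' ∈ M.loopStates p q) (h : M s s' ≠ 0)
    (hne : s ≠ s') (i : ℕ) : i ≤ (N ^ (i + 2)) p q := by
  rw [mem_loopStates] at hs hs'
  have e : N ^ (i + 2) = N * N ^ i * N := by rw [← pow_succ', ← pow_succ]
  calc i ≤ (N ^ i) s s' := N.le_pow_apply hne (hMN _ _ hs.2.1) (hMN _ _ h) (hMN _ _ hs'.2.1) i
    _ ≤ N p s * (N ^ i) s s' := Nat.le_mul_of_pos_left _ (Nat.pos_of_ne_zero (hMN _ _ hs.1))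
    _ ≤ (N * N ^ i) p s' := by
      rw [Matrix.mul_apply]
      exact Finset.single_le_sum (f := fun b => N p b * (N ^ i) b s') (fun _ _ => Nat.zero_le _)
        (Finset.mem_univ s)
    _ ≤ (N * N ^ i) p s' * N s' q :=
      Nat.le_mul_of_pos_right _ (Nat.pos_of_ne_zero (hMN _ _ hs'.2.2))
    _ ≤ (N ^ (i + 2)) p q := by
      rw [e, Matrix.mul_apply (N := N)]
      exact Finset.single_le_sum (f := fun b => (N * N ^ i) p b * N b q)
        (fun _ _ => Nat.zero_le _) (Finset.mem_univ s')

/-- Each loop state is the midpoint of a path of length two. -/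
theorem card_loopStates_le_sq [DecidableEq Q] {M : Matrix Q Q R} {N : Matrix Q Q ℕ} (hMN : M.SupportLE N)
    (p q : Q) : (M.loopStates p q).card ≤ (N ^ 2) p q := by
  rw [Finset.card_eq_sum_ones, pow_two, Matrix.mul_apply]
  refine (Finset.sum_le_sum fun s hs => ?_).trans
    (Finset.sum_le_sum_of_subset (Finset.subset_univ _))
  rw [mem_loopStates] at hs
  exact Nat.mul_pos (Nat.pos_of_ne_zero (hMN _ _ hs.1)) (Nat.pos_of_ne_zero (hMN _ _ hs.2.2))

end Matrix

/-! ### Pumped outputs as maxima of affine functions. -/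

namespace WeightedAutomaton

variable {α Q : Type*} [Fintype Q] [DecidableEq Q] {n : ℕ}

section

variable {R : Type*} [CommSemiring R] (A : WeightedAutomaton α R Q) (r : PumpingRep α n)

/-- The sequences of states around `v₁, …, vₙ` that occur in the runs over `u₀ · v₁ ⋯ vₙ · uₙ`. -/
def Usable (t : Fin n → Q × Q) : Prop :=
  A.contextWeight r.u t * ∏ k, A.wordMatrix (r.v k) (t k).1 (t k).2 ≠ 0

open Classical in
/-- The usable sequences of states, with a choice of a loop state for each of `v₁, …, vₙ`. -/
noncomputable def shapes : Finset (Σ _ : Fin n → Q × Q, Fin n → Q) :=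
  (Finset.univ.filter fun t => A.Usable r t).sigma fun t =>
    Fintype.piFinset fun k => (A.wordMatrix (r.v k)).loopStates (t k).1 (t k).2

variable {A r}

theorem Usable.contextWeight_ne_zero {t : Fin n → Q × Q} (ht : A.Usable r t) :
    A.contextWeight r.u t ≠ 0 :=
  left_ne_zero_of_mul ht

theorem Usable.wordMatrix_ne_zero {t : Fin n → Q × Q} (ht : A.Usable r t) (k : Fin n) :
    A.wordMatrix (r.v k) (t k).1 (t k).2 ≠ 0 := fun h0 =>
  right_ne_zero_of_mul ht (Finset.prod_eq_zero (Finset.mem_univ k) h0)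

theorem Usable.counting_contextWeight_pos {t : Fin n → Q × Q} (ht : A.Usable r t) :
    0 < A.counting.contextWeight r.u t :=
  Nat.pos_of_ne_zero (A.contextWeight_counting_ne_zero _ _ ht.contextWeight_ne_zero)

theorem Usable.prod_le_output_pump {t : Fin n → Q × Q} (ht : A.Usable r t)
    (S : Finset (Fin n)) (i : ℕ) :
    ∏ k, (A.counting.wordMatrix (r.v k) ^ (if k ∈ S then i else 1)) (t k).1 (t k).2 ≤
      A.counting.output (r.pump S i) := by
  rw [output_pump, blockForm_eq_sum]
  exact (Nat.le_mul_of_pos_left _ ht.counting_contextWeight_pos).trans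
    (Finset.single_le_sum (f := fun t => A.counting.contextWeight r.u t *
      ∏ k, (A.counting.wordMatrix (r.v k) ^ (if k ∈ S then i else 1)) (t k).1 (t k).2)
      (fun _ _ => Nat.zero_le _) (Finset.mem_univ t))

theorem Usable.onlyLoops {t : Fin n → Q × Q} (ht : A.Usable r t) {m : ℕ}
    (hm : ∀ w, A.counting.output w ≤ m) (k : Fin n)
    (hk : (A.wordMatrix (r.v k)).SupportIdempotent) :
    (A.wordMatrix (r.v k)).OnlyLoops (t k).1 (t k).2 := by
  refine hk.onlyLoops fun s hs s' hs' h => ?_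
  by_contra hne
  -- Pumping only factor `k`, to exponent `m + 3`, already yields `m + 1` runs.
  have h1 := Matrix.le_pow_apply_of_loopStates (A.supportLE_counting_wordMatrix (r.v k)) hs hs' h
    hne (m + 1)
  have h2 := (ht.prod_le_output_pump {k} (m + 1 + 2)).trans (hm _)
  rw [← Finset.mul_prod_erase _ _ (Finset.mem_univ k), if_pos (Finset.mem_singleton_self k)] at h2
  refine absurd (h1.trans ((Nat.le_mul_of_pos_right _ ?_).trans h2)) (by omega)
  refine Finset.prod_pos fun l hl => Nat.pos_of_ne_zero ?_
  rw [if_neg (by simpa using Finset.ne_of_mem_erase hl), pow_one]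
  exact A.supportLE_counting_wordMatrix _ _ _ (ht.wordMatrix_ne_zero l)

variable (A r)

/-- In the word with all factors doubled, a shape prescribes the endpoints of each block and its
middle state, so different shapes account for different runs. -/
theorem card_shapes_le : (A.shapes r).card ≤ A.counting.output (r.pump Finset.univ 2) := by
  classical
  rw [output_pump, blockForm_eq_sum, shapes, Finset.card_sigma]
  refine (Finset.sum_le_sum fun t ht => ?_).trans
    (Finset.sum_le_sum_of_subset (Finset.subset_univ _))
  rw [Fintype.card_piFinset]
  refine le_trans (Finset.prod_le_prod' fun k _ => ?_) (Nat.le_mul_of_pos_left _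
    (Usable.counting_contextWeight_pos (Finset.mem_filter.1 ht).2))
  rw [if_pos (Finset.mem_univ k)]
  exact Matrix.card_loopStates_le_sq (A.supportLE_counting_wordMatrix _) _ _

end

variable (A : WeightedAutomaton α MaxPlus Q) (r : PumpingRep α n)

theorem output_pump_eq_sum_shapes {m : ℕ} (hm : ∀ w, A.counting.output w ≤ m)
    (hr : ∀ k, (A.wordMatrix (r.v k)).SupportIdempotent) (S : Finset (Fin n)) (j : ℕ) :
    A.output (r.pump S (j + 2)) = ∑ σ ∈ A.shapes r, A.contextWeight r.u σ.1 * ∏ k,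
      if k ∈ S then
        A.wordMatrix (r.v k) (σ.1 k).1 (σ.2 k) * A.wordMatrix (r.v k) (σ.2 k) (σ.2 k) ^ j *
          A.wordMatrix (r.v k) (σ.2 k) (σ.1 k).2
      else A.wordMatrix (r.v k) (σ.1 k).1 (σ.1 k).2 := by
  classical
  rw [output_pump, blockForm_eq_sum, shapes, Finset.sum_sigma,
    ← Finset.sum_subset (Finset.subset_univ (Finset.univ.filter fun t => A.Usable r t))]
  · refine Finset.sum_congr rfl fun t ht => ?_
    have ht := (Finset.mem_filter.1 ht).2
    dsimp only
    rw [← Finset.mul_sum]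
    congr 1
    rw [← Finset.prod_univ_sum (fun k => (A.wordMatrix (r.v k)).loopStates (t k).1 (t k).2)
      fun k s => if k ∈ S then
        A.wordMatrix (r.v k) (t k).1 s * A.wordMatrix (r.v k) s s ^ j *
          A.wordMatrix (r.v k) s (t k).2
      else A.wordMatrix (r.v k) (t k).1 (t k).2]
    refine Finset.prod_congr rfl fun k _ => ?_
    split_ifs
    · exact (hr k).pow_eq_sum (ht.onlyLoops hm k (hr k)) j
    · rw [MaxPlus.sum_const_of_nonempty ((hr k).loopStates_nonempty (ht.wordMatrix_ne_zero k)),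
        pow_one]
  · intro t _ ht
    by_contra h0
    refine ht (Finset.mem_filter.2 ⟨Finset.mem_univ t, mul_ne_zero (left_ne_zero_of_mul h0)
      (Finset.prod_ne_zero_iff.2 fun k hk => ?_)⟩)
    have h1 := Finset.prod_ne_zero_iff.1 (right_ne_zero_of_mul h0) k hk
    split_ifs at h1
    · exact (hr k).of_pow (j + 1) h1
    · simpa using h1

/-- The slope of a shape at `k` is the weight of its loop there, hence independent of `S`; only the
intercepts depend on `S`. -/
theorem exists_affine_pieces {m : ℕ} (hm : ∀ w, A.counting.output w ≤ m)
    (hr : ∀ k, (A.wordMatrix (r.v k)).SupportIdempotent) (f : List α → ℕ)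
    (hf : ∀ w, A.output w = MaxPlus.ofNat (f w)) :
    ∃ c : (Σ _ : Fin n → Q × Q, Fin n → Q) → Fin n → ℕ, (A.shapes r).Nonempty ∧
      ∀ S : Finset (Fin n), ∃ b : (Σ _ : Fin n → Q × Q, Fin n → Q) → ℕ, ∀ j,
        f (r.pump S (j + 2)) = (A.shapes r).sup fun σ => b σ + j * ∑ k ∈ S, c σ k := by
  classical
  obtain ⟨val, hval⟩ := MaxPlus.exists_val
  -- With no shape the output would be `-∞`, but `f` takes finite values.
  have hne : (A.shapes r).Nonempty := by
    by_contra h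
    rw [Finset.not_nonempty_iff_eq_empty] at h
    have := A.output_pump_eq_sum_shapes r hm hr ∅ 0
    rw [h, hf, Finset.sum_empty] at this
    exact MaxPlus.ofNat_ne_zero _ this
  refine ⟨fun σ k => val (A.wordMatrix (r.v k) (σ.2 k) (σ.2 k)), hne, fun S =>
    ⟨fun σ => val (A.contextWeight r.u σ.1 * ∏ k,
      if k ∈ S then A.wordMatrix (r.v k) (σ.1 k).1 (σ.2 k) *
        A.wordMatrix (r.v k) (σ.2 k) (σ.1 k).2
      else A.wordMatrix (r.v k) (σ.1 k).1 (σ.1 k).2), fun j => MaxPlus.ofNat_injective ?_⟩⟩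
  rw [← hf, A.output_pump_eq_sum_shapes r hm hr, ← MaxPlus.sum_ofNat hne]
  refine Finset.sum_congr rfl fun σ hσ => ?_
  obtain ⟨h1, h2⟩ := Finset.mem_sigma.1 hσ
  have ht := (Finset.mem_filter.1 h1).2
  have hl := fun k => Matrix.mem_loopStates.1 (Fintype.mem_piFinset.1 h2 k)
  rw [← MaxPlus.ofNat_mul, ← MaxPlus.ofNat_pow, ← MaxPlus.prod_ofNat, ← hval,
    Finset.prod_congr rfl fun k _ => (hval _ (hl k).2.1).symm, mul_assoc, ← Finset.prod_pow,
    ← Finset.prod_filter_mul_prod_filter_not Finset.univ (· ∈ S),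
    ← Finset.prod_filter_mul_prod_filter_not Finset.univ (· ∈ S)]
  · have e : Finset.univ.filter (· ∈ S) = S := by ext; simp
    rw [mul_right_comm, e, ← Finset.prod_mul_distrib]
    congr 2
    · refine Finset.prod_congr rfl fun k hk => ?_
      rw [if_pos hk, if_pos hk, mul_right_comm]
    · refine Finset.prod_congr rfl fun k hk => ?_
      rw [if_neg (Finset.mem_filter.1 hk).2, if_neg (Finset.mem_filter.1 hk).2]
  · refine mul_ne_zero ht.contextWeight_ne_zero (Finset.prod_ne_zero_iff.2 fun k _ => ?_)
    split_ifs
    · exact mul_ne_zero (hl k).1 (hl k).2.2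
    · exact ht.wordMatrix_ne_zero k

end WeightedAutomaton

/-! ### Linearity, decomposability and the choice of refinement. -/

namespace PumpingRep

variable {α : Type*} {n : ℕ}

theorem exists_isLinear_delta_eq_sup {ι : Type*} {s : Finset ι} (hs : s.Nonempty)
    (c : ι → Fin n → ℕ) (f : List α → ℕ) (r : PumpingRep α n)
    (h : ∀ S : Finset (Fin n), ∃ b : ι → ℕ, ∀ j,
      f (r.pump S (j + 2)) = s.sup fun σ => b σ + j * ∑ k ∈ S, c σ k) :
    ∃ hl : r.IsLinear f, ∀ S, Delta hl S = s.sup fun σ => ∑ k ∈ S, c σ k := by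
  have key : ∀ S : Finset (Fin n), ∀ᶠ i in atTop,
      f (r.pump S (i + 1)) = (s.sup fun σ => ∑ k ∈ S, c σ k) + f (r.pump S i) := by
    intro S
    obtain ⟨b, hb⟩ := h S
    rw [← Filter.map_add_atTop_eq_nat 2, Filter.eventually_map]
    filter_upwards [eventually_sup_affine_succ s hs b fun σ => ∑ k ∈ S, c σ k] with j hj
    rw [add_right_comm, hb, hb, hj]
  exact ⟨fun S => ⟨_, key S⟩, fun S => (Delta_eq_iff _ S _).2 (key S)⟩

/-- A decomposable set has a single piece that is maximal at all its elements. -/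
theorem decomposable_iff {ι : Type*} {s : Finset ι} (hs : s.Nonempty)
    {c : ι → Fin n → ℕ} {f : List α → ℕ} {r : PumpingRep α n} {hl : r.IsLinear f}
    (hD : ∀ S, Delta hl S = s.sup fun σ => ∑ k ∈ S, c σ k) (S : Finset (Fin n)) :
    Decomposable hl S ↔ ∃ σ ∈ s, ∀ k ∈ S, c σ k = Delta hl {k} := by
  have hle : ∀ σ ∈ s, ∀ k, c σ k ≤ Delta hl {k} := by
    intro σ hσ k
    rw [hD]
    simpa using Finset.le_sup (f := fun σ => c σ k) hσ
  constructor
  · intro h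
    obtain ⟨σ, hσ, e⟩ := s.exists_mem_eq_sup hs fun σ => ∑ k ∈ S, c σ k
    rw [← hD, show Delta hl S = ∑ k ∈ S, Delta hl {k} from h] at e
    -- Termwise inequalities with equal sums are termwise equalities.
    exact ⟨σ, hσ, (Finset.sum_eq_sum_iff_of_le fun k _ => hle σ hσ k).1 e.symm⟩
  · rintro ⟨σ, hσ, h⟩
    refine le_antisymm ?_ ?_
    · rw [hD]
      exact Finset.sup_le fun τ hτ => Finset.sum_le_sum fun k _ => hle τ hτ k
    · rw [hD, ← Finset.sum_congr rfl h]
      exact Finset.le_sup (f := fun σ => ∑ k ∈ S, c σ k) hσ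

/-- Every representation whose underlined factors are long has a refinement whose underlined
factors have idempotent supports. -/
theorem exists_isRefinement_supportIdempotent {R Q : Type*} [CommSemiring R] [NoZeroDivisors R]
    [Fintype Q] [DecidableEq Q] (A : WeightedAutomaton α R Q)
    (hR : ∀ x y : R, x + y = 0 → x = 0 ∧ y = 0) :
    ∃ N : ℕ, ∀ (n : ℕ) (r : PumpingRep α n), (∀ k, N ≤ (r.v k).length) →
      ∃ r' : PumpingRep α n, r'.IsRefinement r ∧
        ∀ k, (A.wordMatrix (r'.v k)).SupportIdempotent := by
  classical
  have hsum : ∀ (s : Finset Q) (g : Q → R), (∃ t ∈ s, g t ≠ 0) → ∑ t ∈ s, g t ≠ 0 := by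
    rintro s g ⟨t, ht, h⟩ h0
    rw [← Finset.add_sum_erase s g ht] at h0
    exact h (hR _ _ h0).1
  have hmul : ∀ (M M' : Matrix Q Q R) (p q : Q),
      (M * M') p q ≠ 0 ↔ ∃ t, M p t ≠ 0 ∧ M' t q ≠ 0 := by
    intro M M' p q
    rw [Matrix.mul_apply]
    constructor
    · intro h
      obtain ⟨t, -, ht⟩ := Finset.exists_ne_zero_of_sum_ne_zero h
      exact ⟨t, left_ne_zero_of_mul ht, right_ne_zero_of_mul ht⟩
    · rintro ⟨t, h1, h2⟩
      exact hsum _ _ ⟨t, Finset.mem_univ t, mul_ne_zero h1 h2⟩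
  obtain ⟨N, hN⟩ := exists_repetitive_factor (α := α)
    fun w => ({x | A.wordMatrix w x.1 x.2 ≠ 0} : Set (Q × Q))
  refine ⟨N, fun n r hr => ?_⟩
  choose x y₁ y₂ z h1 h2 h3 h4 using fun k => hN (r.v k) (hr k)
  -- The leftovers of each factor move into the neighbouring contexts; `Fin.cases` and `Fin.snoc`
  -- supply the empty words at the two ends.
  refine ⟨⟨fun k => Fin.cases [] z k ++ r.u k ++ Fin.snoc (α := fun _ => List α) x [] k,
    fun k => y₁ k ++ y₂ k, r.pos, fun k => by simp [h2 k]⟩,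
    ⟨Fin.snoc (α := fun _ => List α) x [], fun k => Fin.cases [] z k, rfl, by simp,
      fun k => by simp [h1 k], fun k => rfl⟩, fun k p q => ?_⟩
  have e3 : ∀ p q, A.wordMatrix (y₁ k) p q ≠ 0 ↔ A.wordMatrix (y₁ k ++ y₂ k) p q ≠ 0 :=
    fun p q => Set.ext_iff.1 (h3 k) (p, q)
  have e4 : ∀ p q, A.wordMatrix (y₂ k) p q ≠ 0 ↔ A.wordMatrix (y₁ k ++ y₂ k) p q ≠ 0 :=
    fun p q => Set.ext_iff.1 (h4 k) (p, q)
  change A.wordMatrix (y₁ k ++ y₂ k) p q ≠ 0 ↔ ∃ t, A.wordMatrix (y₁ k ++ y₂ k) p t ≠ 0 ∧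
    A.wordMatrix (y₁ k ++ y₂ k) t q ≠ 0
  -- Exchanging `y` for `y₁` in the first step and `y₂` in the second turns idempotence into the
  -- product rule for `y = y₁ y₂`.
  simp only [← e3 p, ← e4 _ q]
  rw [e3, A.wordMatrix_append, hmul]

end PumpingRep

/-! ### The pigeonhole argument. -/

theorem mainTheorem4 {α : Type*} [Finite α] (f : List α → ℕ)
    (hf : IsFinitelyAmbiguousMaxPlus f) :
    ∃ N : ℕ, ∀ (n : ℕ) (r : PumpingRep α n), N ≤ n → (∀ k, N ≤ (r.v k).length) →
      ∃ r' : PumpingRep α n, r'.IsRefinement r ∧ ∃ h : r'.IsLinear f,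
        ∀ (k : ℕ) (S : Fin k → Finset (Fin n)), N ≤ k → Function.Injective S →
          (∀ j, (S j).Nonempty) →
          (∃ j, ¬ PumpingRep.Decomposable h (S j)) ∨
          (∃ j₁ j₂, j₁ ≠ j₂ ∧ ∀ l₁ ∈ S j₁, ∀ l₂ ∈ S j₂,
            PumpingRep.Decomposable h {l₁, l₂}) := by
  obtain ⟨d, A, ⟨m, hm⟩, hA⟩ := hf
  have hm' : ∀ w, A.counting.output w ≤ m := fun w => by
    exact_mod_cast (A.counting_output w).trans_le (hm w)
  obtain ⟨N, hN⟩ := PumpingRep.exists_isRefinement_supportIdempotent A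
    fun x y => Tropical.add_eq_zero_iff.1
  -- `N` makes the factors long enough to refine; `m + 1` exceeds the number of shapes.
  refine ⟨max N (m + 1), fun n r _ hr => ?_⟩
  obtain ⟨r', href, hr'⟩ := hN n r fun k => (le_max_left _ _).trans (hr k)
  obtain ⟨c, hne, hc⟩ := A.exists_affine_pieces r' hm' hr' f hA
  obtain ⟨hl, hD⟩ := PumpingRep.exists_isLinear_delta_eq_sup hne c f r' hc
  refine ⟨r', href, hl, fun k S hk _ _ => ?_⟩
  by_contra! hcon
  obtain ⟨hdec, hpair⟩ := hcon
  choose σ hσ hmax using fun j => (PumpingRep.decomposable_iff hne hD (S j)).1 (hdec j)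
  have hcard : (A.shapes r').card < (Finset.univ : Finset (Fin k)).card := by
    have := (A.card_shapes_le r').trans (hm' _)
    rw [Finset.card_univ, Fintype.card_fin]
    omega
  obtain ⟨j₁, -, j₂, -, hj, e⟩ :=
    Finset.exists_ne_map_eq_of_card_lt_of_maps_to hcard fun j _ => hσ j
  obtain ⟨l₁, h₁, l₂, h₂, h⟩ := hpair j₁ j₂ hj
  refine h ((PumpingRep.decomposable_iff hne hD _).2 ⟨σ j₁, hσ j₁, fun l hl' => ?_⟩)
  rcases Finset.mem_insert.1 hl' with rfl | hl'
  · exact hmax j₁ _ h₁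
  · rw [Finset.mem_singleton.1 hl', e]
    exact hmax j₂ _ h₂
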